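/- Let $d_x,d_y\in\mathbb{N}$ and $\varepsilon>0$. Let $\mu$ be a Borel probability measure on $\mathbb{R}^{d_y}$ and let $\nu$ be the law of a random vector $(X,Y)\in\mathbb{R}^{d_x}\times\mathbb{R}^{d_y}$ with $\mathbb{E}[X]=0$. Put $c(u,y)=\tfrac12\|u-y\|^2$. For $(f,g,h)\in L^1(\mu)\times L^1(\mu;\mathbb{R}^{d_x})\times L^1(\nu)$ let $$D^\varepsilon(f,g,h)=\int f\,d\mu+\int h\,d\nu-\varepsilon\int e^{\frac1\varepsilon(f(u)+\langle g(u),x\rangle+h(x,y)-c(u,y))}\,d(\mu\otimes\nu)(u,x,y)+\varepsilon\in[-\infty,\infty),$$ and call $(f,g,h)$ dual potentials if it attains the supremum of $D^\varepsilon$ over $L^1(\mu)\times L^1(\mu;\mathbb{R}^{d_x})\times L^1(\nu)$. Assume that the matrix $\mathbb{E}[XX^\top]$ is invertible and that the supports of $\mu$, of (the law of) $X$ and of (the law of) $Y$ are compact. Let $(f_0,g_0,h_0)$ be dual potentials. Consider versions of them, that is, functions $f^\varepsilon:\mathbb{R}^{d_y}\to[-\infty,\infty]$, $g^\varepsilon:\mathbb{R}^{d_y}\to\mathbb{R}^{d_x}$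 and $h^\varepsilon:\mathbb{R}^{d_x+d_y}\to[-\infty,\infty]$ with $f^\varepsilon=f_0$ and $g^\varepsilon=g_0$ $\mu$-a.e. and $h^\varepsilon=h_0$ $\nu$-a.e., which solve the following Schrödinger-like system at every $u\in\mathbb{R}^{d_y}$ and every $(x,y)\in\mathbb{R}^{d_x+d_y}$: $$f^\varepsilon(u)=-\varepsilon\log\int e^{\frac1\varepsilon(\langle g^\varepsilon(u),x'\rangle+h^\varepsilon(x',y')-c(u,y'))}\,d\nu(x',y'),$$ $$\int x'\,e^{\frac1\varepsilon(\langle g^\varepsilon(u),x'\rangle+h^\varepsilon(x',y')-c(u,y'))}\,d\nu(x',y')=0\quad\text{(absolutely convergent)},$$ $$h^\varepsilon(x,y)=-\varepsilon\log\int e^{\frac1\varepsilon(f^\varepsilon(u')+\langle g^\varepsilon(u'),x\rangle-c(u',y))}\,d\mu(u').$$ Then such versions exist, and for all such versions: (i) $f^\varepsilon$ is everywhere finite, and $f^\varepsilon$ and each coordinate of $g^\varepsilon$ are real analytic functions on $\mathbb{R}^{d_y}$; (ii) $h^\varepsilon$ is everywhere finite and is a real analytic function on $\mathbb{R}^{d_x+d_y}$.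 -/

import Mathlib

open MeasureTheory Filter
open scoped ENNReal

namespace EntropicVQR

/-- `ℝ^d` with its Euclidean norm. -/
abbrev Euc (d : ℕ) : Type := EuclideanSpace ℝ (Fin d)

/-- The quadratic cost `c(u, y) = ‖u - y‖² / 2`. -/
noncomputable def cost {dy : ℕ} (u y : Euc dy) : ℝ := ‖u - y‖ ^ 2 / 2

/-- The matrix `E[X Xᵀ]`, where `(X, Y)` has law `ν`. -/
noncomputable def secondMoment {dx dy : ℕ} (ν : Measure (Euc dx × Euc dy)) :
    Matrix (Fin dx) (Fin dx) ℝ :=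
  Matrix.of fun i j => ∫ z, z.1 i * z.1 j ∂ν

/-- The dual objective of entropic vector quantile regression,
`∫ f dμ + ∫ h dν - (ε ∫ exp ((f(u) + ⟨g(u), x⟩ + h(x,y) - c(u,y)) / ε) d(μ ⊗ ν) - ε)`.
The last integral is taken in `[0, ∞]`, so the objective has values in `[-∞, ∞)`
on integrable triples. -/
noncomputable def dualObjective {dx dy : ℕ} (μ : Measure (Euc dy))
    (ν : Measure (Euc dx × Euc dy)) (ε : ℝ)
    (f : Euc dy → ℝ) (g : Euc dy → Euc dx) (h : Euc dx × Euc dy → ℝ) : EReal :=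
  ((∫ u, f u ∂μ + ∫ z, h z ∂ν : ℝ) : EReal)
    - ((ε : EReal) *
        ((∫⁻ p, ENNReal.ofReal (Real.exp
            ((f p.1 + inner ℝ (g p.1) p.2.1 + h p.2 - cost p.1 p.2.2) / ε))
          ∂(μ.prod ν) : ℝ≥0∞) : EReal)
      - (ε : EReal))

/-- Dual potentials: triples in `L¹(μ) × L¹(μ; ℝ^dx) × L¹(ν)` that attain the supremum of the
dual objective over `L¹(μ) × L¹(μ; ℝ^dx) × L¹(ν)`. -/
structure IsDualPotentials {dx dy : ℕ} (μ : Measure (Euc dy))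
    (ν : Measure (Euc dx × Euc dy)) (ε : ℝ)
    (f : Euc dy → ℝ) (g : Euc dy → Euc dx) (h : Euc dx × Euc dy → ℝ) : Prop where
  integrable_f : Integrable f μ
  integrable_g : Integrable g μ
  integrable_h : Integrable h ν
  isMax : ∀ (f' : Euc dy → ℝ) (g' : Euc dy → Euc dx) (h' : Euc dx × Euc dy → ℝ),
    Integrable f' μ → Integrable g' μ → Integrable h' ν →
      dualObjective μ ν ε f' g' h' ≤ dualObjective μ ν ε f g h

/-- `(f, g, h)` is a version of `(f₀, g₀, h₀)`; `f` and `h` may take infinite values on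
null sets. -/
structure IsVersion {dx dy : ℕ} (μ : Measure (Euc dy)) (ν : Measure (Euc dx × Euc dy))
    (f₀ : Euc dy → ℝ) (g₀ : Euc dy → Euc dx) (h₀ : Euc dx × Euc dy → ℝ)
    (f : Euc dy → EReal) (g : Euc dy → Euc dx) (h : Euc dx × Euc dy → EReal) : Prop where
  f_ae : f =ᵐ[μ] fun u => (f₀ u : EReal)
  g_ae : g =ᵐ[μ] g₀
  h_ae : h =ᵐ[ν] fun z => (h₀ z : EReal)

/-- The weight `exp ((⟨θ, x⟩ + h(x,y) - c(u,y)) / ε)`, with values in `[0, ∞]`. -/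
noncomputable def weight {dx dy : ℕ} (ε : ℝ) (h : Euc dx × Euc dy → EReal)
    (θ : Euc dx) (u : Euc dy) (z : Euc dx × Euc dy) : ℝ≥0∞ :=
  EReal.exp ((h z + ((inner ℝ θ z.1 - cost u z.2 : ℝ) : EReal)) / (ε : EReal))

/-- The Schrödinger-like system, with all three equations holding at every point. The first and
third equations are identities in `[-∞, ∞]`; the integral in the second one is required to
converge absolutely. -/
structure SolvesSystem {dx dy : ℕ} (μ : Measure (Euc dy)) (ν : Measure (Euc dx × Euc dy))
    (ε : ℝ) (f : Euc dy → EReal) (g : Euc dy → Euc dx) (h : Euc dx × Euc dy → EReal) :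
    Prop where
  eq_f : ∀ u, f u = -((ε : EReal) * ENNReal.log (∫⁻ z, weight ε h (g u) u z ∂ν))
  integrable_g : ∀ u, Integrable (fun z => (weight ε h (g u) u z).toReal • z.1) ν
  eq_g : ∀ u, ∫ z, (weight ε h (g u) u z).toReal • z.1 ∂ν = 0
  eq_h : ∀ (x : Euc dx) (y : Euc dy), h (x, y) = -((ε : EReal) * ENNReal.log
    (∫⁻ u, EReal.exp ((f u + ((inner ℝ (g u) x - cost u y : ℝ) : EReal)) / (ε : EReal)) ∂μ))

end EntropicVQR

namespace EntropicVQR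

/-! Maximality of `(f₀, g₀, h₀)` is tested against small bounded perturbations. The first-order
condition says that the Gibbs density has both marginal integrals equal to one and conditional mean
of `X` equal to zero given `u`, which is the Schrödinger-like system almost everywhere.

Expanding the square in the cost turns the exponent into a linear functional of `(u, θ)`, up to
terms in `u` alone and in `z` alone. With the weight `k = baseWeight ε h₀`, the system concerns
`partition`, a Laplace-type integral of `k`, and `moment`, which is `ε` times its gradient in `θ`.
As `E[X] = 0` and `E[XXᵀ]` is invertible, `partition` is coercive in `θ` and `moment` is injective
in `θ`, so for each `u` there is exactly one `θ` with zero moment (`exists_moment_eq_zero`,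
`moment_injective`). This gives existence of versions. For any version, `h` enters only through
integrals against `ν`, so `g u` must be this zero.

Integrals of exponentials of linear functionals over a compact set are analytic
(`analyticAt_integral_exp`). The analytic implicit function theorem then makes `g` analytic, and `f`
is a quadratic minus `ε` times the logarithm of a positive analytic function. Continuity of `f` and
`g` on the compact support of `μ` lets the same argument, with the roles of `μ` and `ν` exchanged,
treat `h`. -/

open scoped Topology ContDiff

/-! ### Analyticity of exponential integrals over compact sets -/

/-- Integration against an integrable vector-valued function, as a continuous linear map on
continuous functions on a compact space. -/
noncomputable def integralSMulCLM {K F : Type*} [TopologicalSpace K] [CompactSpace K]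
    [SecondCountableTopology K] [MeasurableSpace K] [BorelSpace K] [NormedAddCommGroup F]
    [NormedSpace ℝ F] (ρ : Measure K) {v : K → F} (hv : Integrable v ρ) : C(K, ℝ) →L[ℝ] F :=
  have hint (φ : C(K, ℝ)) : Integrable (fun z => φ z • v z) ρ :=
    hv.bdd_smul ‖φ‖ φ.continuous.aestronglyMeasurable (ae_of_all _ φ.norm_coe_le_norm)
  LinearMap.mkContinuous
    { toFun := fun φ => ∫ z, φ z • v z ∂ρ
      map_add' := fun φ ψ => by
        simp only [ContinuousMap.add_apply, add_smul]
        exact integral_add (hint φ) (hint ψ)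
      map_smul' := fun c φ => by
        simp only [ContinuousMap.smul_apply, smul_assoc, RingHom.id_apply]
        exact integral_smul _ _ }
    (∫ z, ‖v z‖ ∂ρ) fun φ => by
      rw [mul_comm, ← integral_const_mul]
      refine norm_integral_le_of_norm_le (hv.norm.const_mul _) (ae_of_all _ fun z => ?_)
      rw [norm_smul]
      exact mul_le_mul_of_nonneg_right (φ.norm_coe_le_norm z) (norm_nonneg _)

theorem integralSMulCLM_apply {K F : Type*} [TopologicalSpace K] [CompactSpace K]
    [SecondCountableTopology K] [MeasurableSpace K] [BorelSpace K] [NormedAddCommGroup F]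
    [NormedSpace ℝ F] (ρ : Measure K) {v : K → F} (hv : Integrable v ρ) (φ : C(K, ℝ)) :
    integralSMulCLM ρ hv φ = ∫ z, φ z • v z ∂ρ := rfl

/-- Evaluation at a point is a continuous algebra homomorphism, so it commutes with the exponential
series. -/
theorem exp_continuousMap_apply {K : Type*} [TopologicalSpace K] [CompactSpace K]
    (φ : C(K, ℝ)) (z : K) : NormedSpace.exp φ z = Real.exp (φ z) := by
  have h := NormedSpace.map_exp (𝔸 := C(K, ℝ)) (𝔹 := ℝ)
    ((ContinuousMap.evalAlgHom ℝ ℝ z : C(K, ℝ) →ₐ[ℝ] ℝ))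
    (ContinuousEvalConst.continuous_eval_const z) φ
  rw [Real.exp_eq_exp_ℝ]
  exact h

/-- Evaluation of a continuous family of functionals, as a continuous linear map. -/
noncomputable def familyCLM {K E : Type*} [TopologicalSpace K] [CompactSpace K]
    [NormedAddCommGroup E] [NormedSpace ℝ E] [FiniteDimensional ℝ E] (ℓ : C(K, E →L[ℝ] ℝ)) :
    E →L[ℝ] C(K, ℝ) :=
  LinearMap.toContinuousLinearMap
    { toFun := fun p => ⟨fun z => ℓ z p, by fun_prop⟩
      map_add' := fun p q => by ext z; simp
      map_smul' := fun c p => by ext z; simp }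

theorem familyCLM_apply {K E : Type*} [TopologicalSpace K] [CompactSpace K]
    [NormedAddCommGroup E] [NormedSpace ℝ E] [FiniteDimensional ℝ E] (ℓ : C(K, E →L[ℝ] ℝ))
    (p : E) (z : K) : familyCLM ℓ p z = ℓ z p := rfl

section
variable {K E F : Type*} [TopologicalSpace K] [CompactSpace K]
    [SecondCountableTopology K] [MeasurableSpace K] [BorelSpace K]
    [NormedAddCommGroup E] [NormedSpace ℝ E] [FiniteDimensional ℝ E] [NormedAddCommGroup F]
    [NormedSpace ℝ F] (ρ : Measure K) {v : K → F} (hv : Integrable v ρ) (ℓ : C(K, E →L[ℝ] ℝ))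

include hv

/-- The integral factors as a continuous linear map into `C(K, ℝ)`, the exponential of that Banach
algebra, and a continuous linear map out of it; all three are analytic. No power series has to be
estimated by hand. -/
theorem analyticAt_integral_exp_of_compactSpace (p : E) :
    AnalyticAt ℝ (fun p => ∫ z, Real.exp (ℓ z p) • v z ∂ρ) p := by
  have h : (fun p => ∫ z, Real.exp (ℓ z p) • v z ∂ρ) =
      integralSMulCLM ρ hv ∘ NormedSpace.exp ∘ familyCLM ℓ := by
    ext p
    simp [integralSMulCLM_apply, exp_continuousMap_apply, familyCLM_apply]
  rw [h]
  exact ((integralSMulCLM ρ hv).analyticAt _).comp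
    ((NormedSpace.exp_analytic (𝕂 := ℝ) _).comp ((familyCLM ℓ).analyticAt p))

theorem fderiv_integral_exp_of_compactSpace (p q : E) :
    fderiv ℝ (fun p => ∫ z, Real.exp (ℓ z p) • v z ∂ρ) p q =
      ∫ z, (Real.exp (ℓ z p) * ℓ z q) • v z ∂ρ := by
  have h : (fun p => ∫ z, Real.exp (ℓ z p) • v z ∂ρ) =
      integralSMulCLM ρ hv ∘ NormedSpace.exp ∘ familyCLM ℓ := by
    ext p
    simp [integralSMulCLM_apply, exp_continuousMap_apply, familyCLM_apply]
  have h' := ((integralSMulCLM ρ hv).hasFDerivAt).comp p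
    (((hasStrictFDerivAt_exp (𝕂 := ℝ) (x := familyCLM ℓ p)).hasFDerivAt).comp p
      (familyCLM ℓ).hasFDerivAt)
  rw [h, h'.fderiv]
  simp [integralSMulCLM_apply, exp_continuousMap_apply, familyCLM_apply]

end

section
variable {Ω E F : Type*} [TopologicalSpace Ω] [T2Space Ω]
    [SecondCountableTopology Ω] [MeasurableSpace Ω] [BorelSpace Ω]
    [NormedAddCommGroup E] [NormedSpace ℝ E] [FiniteDimensional ℝ E] [NormedAddCommGroup F]
    [NormedSpace ℝ F] {ρ : Measure Ω} {K : Set Ω} (hK : IsCompact K) (hρ : ∀ᵐ z ∂ρ, z ∈ K)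
    {v : Ω → F} (hv : Integrable v ρ) {ℓ : Ω → E →L[ℝ] ℝ} (hℓ : ContinuousOn ℓ K)

include hK hρ

omit [SecondCountableTopology Ω] in
theorem integral_eq_integral_comap_subtype (φ : Ω → F) :
    ∫ z, φ z ∂ρ = ∫ z : K, φ z ∂(ρ.comap Subtype.val) := by
  rw [integral_subtype_comap hK.measurableSet, Measure.restrict_eq_self_of_ae_mem hρ]

omit [T2Space Ω] [SecondCountableTopology Ω] in
theorem integrable_continuous_smul {φ : Ω → ℝ} (hφ : Continuous φ) {v : Ω → F}
    (hv : Integrable v ρ) : Integrable (fun z => φ z • v z) ρ := by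
  obtain ⟨C, hC⟩ := hK.exists_bound_of_continuousOn hφ.continuousOn
  exact hv.bdd_smul C hφ.aestronglyMeasurable (hρ.mono hC)

include hv hℓ

theorem analyticAt_integral_exp (p : E) :
    AnalyticAt ℝ (fun p => ∫ z, Real.exp (ℓ z p) • v z ∂ρ) p := by
  have := isCompact_iff_compactSpace.mp hK
  simp only [integral_eq_integral_comap_subtype hK hρ]
  exact analyticAt_integral_exp_of_compactSpace (ρ.comap Subtype.val)
    ((integrableOn_iff_comap_subtypeVal hK.measurableSet).mp hv.integrableOn)
    ⟨K.domRestrict ℓ, hℓ.domRestrict⟩ p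

theorem fderiv_integral_exp (p q : E) :
    fderiv ℝ (fun p => ∫ z, Real.exp (ℓ z p) • v z ∂ρ) p q =
      ∫ z, (Real.exp (ℓ z p) * ℓ z q) • v z ∂ρ := by
  have := isCompact_iff_compactSpace.mp hK
  simp only [integral_eq_integral_comap_subtype hK hρ]
  exact fderiv_integral_exp_of_compactSpace (ρ.comap Subtype.val)
    ((integrableOn_iff_comap_subtypeVal hK.measurableSet).mp hv.integrableOn)
    ⟨K.domRestrict ℓ, hℓ.domRestrict⟩ p q

end

/-! ### Tilted integrals: convexity, coercivity and the implicit function -/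

/-- The linear functional `(u, θ) ↦ (⟨θ, x⟩ + ⟨u, y⟩) / ε` attached to `z = (x, y)`. -/
noncomputable def pairing {dx dy : ℕ} (ε : ℝ) (z : Euc dx × Euc dy) :
    Euc dy × Euc dx →L[ℝ] ℝ :=
  ε⁻¹ • ((innerSL ℝ z.1).comp (ContinuousLinearMap.snd ℝ (Euc dy) (Euc dx)) +
    (innerSL ℝ z.2).comp (ContinuousLinearMap.fst ℝ (Euc dy) (Euc dx)))

theorem pairing_apply {dx dy : ℕ} (ε : ℝ) (z : Euc dx × Euc dy) (p : Euc dy × Euc dx) :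
    pairing ε z p = (inner ℝ p.2 z.1 + inner ℝ p.1 z.2) / ε := by
  simp [pairing, real_inner_comm, div_eq_inv_mul, mul_add]

theorem continuous_pairing {dx dy : ℕ} (ε : ℝ) :
    Continuous (pairing ε : Euc dx × Euc dy → Euc dy × Euc dx →L[ℝ] ℝ) := by
  unfold pairing
  fun_prop

/-- The exponential integral of the weight `k`. -/
noncomputable def partition {dx dy : ℕ} (ν : Measure (Euc dx × Euc dy)) (ε : ℝ)
    (k : Euc dx × Euc dy → ℝ) (p : Euc dy × Euc dx) : ℝ :=
  ∫ z, Real.exp (pairing ε z p) • k z ∂ν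

/-- The first moment in `x` of the exponentially tilted weight `k`. -/
noncomputable def moment {dx dy : ℕ} (ν : Measure (Euc dx × Euc dy)) (ε : ℝ)
    (k : Euc dx × Euc dy → ℝ) (p : Euc dy × Euc dx) : Euc dx :=
  ∫ z, Real.exp (pairing ε z p) • (k z • z.1) ∂ν

section
variable {dx dy : ℕ} {ν : Measure (Euc dx × Euc dy)} [IsProbabilityMeasure ν]
  {K : Set (Euc dx × Euc dy)} (hK : IsCompact K) (hν : ∀ᵐ z ∂ν, z ∈ K)

include hK hν

theorem integrable_of_continuous {φ : Euc dx × Euc dy → ℝ} (hφ : Continuous φ) :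
    Integrable φ ν := by
  simpa using integrable_continuous_smul hK hν hφ (integrable_const (1 : ℝ))

omit [IsProbabilityMeasure ν] in
theorem integrable_smul_fst {k : Euc dx × Euc dy → ℝ} (hk : Integrable k ν) :
    Integrable (fun z => k z • z.1) ν := by
  obtain ⟨C, hC⟩ := hK.exists_bound_of_continuousOn (f := fun z : Euc dx × Euc dy => z.1)
    continuous_fst.continuousOn
  exact hk.smul_bdd C continuous_fst.aestronglyMeasurable (hν.mono hC)

theorem integrable_fst : Integrable (fun z => z.1) ν := by
  simpa using integrable_smul_fst hK hν (integrable_const (1 : ℝ))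

/-- The vector `E[XXᵀ] η = E[X ⟨η, X⟩]` vanishes, and the matrix is invertible. This is the only way
in which invertibility enters. -/
theorem eq_zero_of_ae_inner_eq_zero (hinv : IsUnit (secondMoment ν)) {η : Euc dx}
    (h : ∀ᵐ z ∂ν, inner ℝ η z.1 = 0) : η = 0 := by
  have hmul : (secondMoment ν).mulVec η = 0 := by
    ext i
    simp only [Matrix.mulVec, dotProduct, secondMoment, Matrix.of_apply, Pi.zero_apply,
      ← integral_mul_const]
    rw [← integral_finsetSum]
    · refine integral_eq_zero_of_ae (h.mono fun z hz => ?_)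
      simp only [PiLp.inner_apply, RCLike.inner_apply, conj_trivial] at hz
      simp only [mul_assoc, ← Finset.mul_sum, hz, mul_zero, Pi.zero_apply]
    · exact fun j _ => integrable_of_continuous hK hν (by fun_prop)
  have := Matrix.mulVec_injective_of_isUnit hinv (hmul.trans (Matrix.mulVec_zero _).symm)
  ext i
  exact congrFun this i

omit [IsProbabilityMeasure ν] in
theorem inner_moment {ε : ℝ} {k : Euc dx × Euc dy → ℝ} (hk : Integrable k ν)
    (p : Euc dy × Euc dx) (η : Euc dx) :
    inner ℝ η (moment ν ε k p) = ∫ z, Real.exp (pairing ε z p) * k z * inner ℝ η z.1 ∂ν := by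
  rw [moment, ← integral_inner]
  · simp only [inner_smul_right, mul_assoc]
  · exact integrable_continuous_smul hK hν
      (by have := continuous_pairing (dx := dx) (dy := dy) ε; fun_prop)
      (integrable_smul_fst hK hν hk)

omit [IsProbabilityMeasure ν] in
theorem integrable_tilt {ε : ℝ} {k : Euc dx × Euc dy → ℝ} (hk : Integrable k ν)
    (p : Euc dy × Euc dx) {φ : Euc dx × Euc dy → ℝ} (hφ : Continuous φ) :
    Integrable (fun z => Real.exp (pairing ε z p) * k z * φ z) ν := by
  have hc : Continuous fun z : Euc dx × Euc dy => Real.exp (pairing ε z p) * φ z := by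
    have := continuous_pairing (dx := dx) (dy := dy) ε
    fun_prop
  refine (integrable_continuous_smul hK hν hc hk).congr (ae_of_all _ fun z => ?_)
  simp only [smul_eq_mul]
  ring

/-- Strict monotonicity of a gradient: pairing the difference of moments with `θ - η` integrates
`(exp a - exp b) * (a - b)`, which is nonnegative and vanishes only for `a = b`, against a positive
weight. -/
theorem moment_injective (hinv : IsUnit (secondMoment ν)) {ε : ℝ} (hε : 0 < ε)
    {k : Euc dx × Euc dy → ℝ} (hk : Integrable k ν) (hpos : ∀ z, 0 < k z) {u : Euc dy}
    {θ η : Euc dx} (h : moment ν ε k (u, θ) = moment ν ε k (u, η)) : θ = η := by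
  rw [← sub_eq_zero]
  apply eq_zero_of_ae_inner_eq_zero hK hν hinv
  have hint (p) := integrable_tilt hK hν (ε := ε) hk p
    (φ := fun z => inner ℝ (θ - η) z.1) (by fun_prop)
  have h0 : ∫ z, (Real.exp (pairing ε z (u, θ)) * k z * inner ℝ (θ - η) z.1 -
      Real.exp (pairing ε z (u, η)) * k z * inner ℝ (θ - η) z.1) ∂ν = 0 := by
    rw [integral_sub (hint _) (hint _), ← inner_moment hK hν hk, ← inner_moment hK hν hk, h,
      sub_self]
  have hform (z : Euc dx × Euc dy) : inner ℝ (θ - η) z.1 =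
      ε * (pairing ε z (u, θ) - pairing ε z (u, η)) := by
    simp only [pairing_apply, inner_sub_left]
    field_simp
    ring
  have hfac (z : Euc dx × Euc dy) : Real.exp (pairing ε z (u, θ)) * k z * inner ℝ (θ - η) z.1 -
      Real.exp (pairing ε z (u, η)) * k z * inner ℝ (θ - η) z.1 =
      (k z * ε) * ((Real.exp (pairing ε z (u, θ)) - Real.exp (pairing ε z (u, η))) *
        (pairing ε z (u, θ) - pairing ε z (u, η))) := by
    rw [hform]; ring
  have hnn : ∀ a b : ℝ, 0 ≤ (Real.exp a - Real.exp b) * (a - b) := fun a b => by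
    rcases le_total a b with hab | hab
    · exact mul_nonneg_of_nonpos_of_nonpos (by simpa using hab) (by simpa using hab)
    · exact mul_nonneg (by simpa using hab) (by simpa using hab)
  rw [integral_eq_zero_iff_of_nonneg] at h0
  · filter_upwards [h0] with z hz
    simp only [Pi.zero_apply] at hz
    rw [hfac] at hz
    rcases mul_eq_zero.mp hz with h1 | h1
    · exact absurd h1 (mul_pos (hpos z) hε).ne'
    · rw [hform]
      rcases mul_eq_zero.mp h1 with h2 | h2
      · rw [Real.exp_injective (sub_eq_zero.mp h2)]; simp
      · rw [h2, mul_zero]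
  · intro z
    simp only [Pi.zero_apply]
    rw [hfac]
    exact mul_nonneg (mul_pos (hpos z) hε).le (hnn _ _)
  · exact (hint _).sub (hint _)

omit [IsProbabilityMeasure ν] in
theorem analyticAt_partition {ε : ℝ} {k : Euc dx × Euc dy → ℝ} (hk : Integrable k ν)
    (p : Euc dy × Euc dx) : AnalyticAt ℝ (partition ν ε k) p :=
  analyticAt_integral_exp hK hν hk (continuous_pairing ε).continuousOn p

omit [IsProbabilityMeasure ν] in
theorem analyticAt_moment {ε : ℝ} {k : Euc dx × Euc dy → ℝ} (hk : Integrable k ν)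
    (p : Euc dy × Euc dx) : AnalyticAt ℝ (moment ν ε k) p :=
  analyticAt_integral_exp hK hν (integrable_smul_fst hK hν hk)
    (continuous_pairing ε).continuousOn p

omit [IsProbabilityMeasure ν] in
theorem fderiv_partition_inr {ε : ℝ} {k : Euc dx × Euc dy → ℝ} (hk : Integrable k ν)
    (p : Euc dy × Euc dx) (η : Euc dx) :
    fderiv ℝ (partition ν ε k) p (0, η) = inner ℝ η (moment ν ε k p) / ε := by
  have h := fderiv_integral_exp hK hν hk (continuous_pairing ε).continuousOn p (0, η)
  rw [inner_moment hK hν hk, ← integral_div]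
  refine h.trans (integral_congr_ae (ae_of_all _ fun z => ?_))
  simp [pairing_apply]
  ring

omit [IsProbabilityMeasure ν] in
theorem inner_fderiv_moment_inr {ε : ℝ} {k : Euc dx × Euc dy → ℝ} (hk : Integrable k ν)
    (p : Euc dy × Euc dx) (η : Euc dx) :
    inner ℝ η (fderiv ℝ (moment ν ε k) p (0, η)) =
      ∫ z, Real.exp (pairing ε z p) * k z * (inner ℝ η z.1 ^ 2 / ε) ∂ν := by
  have h := fderiv_integral_exp hK hν (integrable_smul_fst hK hν hk)
    (continuous_pairing ε).continuousOn p (0, η)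
  have hc := continuous_pairing (dx := dx) (dy := dy) ε
  have h' : fderiv ℝ (moment ν ε k) p (0, η) = _ := h
  rw [h', ← integral_inner]
  · refine integral_congr_ae (ae_of_all _ fun z => ?_)
    simp [pairing_apply, inner_smul_right]
    ring
  · exact integrable_continuous_smul hK hν (by fun_prop) (integrable_smul_fst hK hν hk)

/-- The quadratic form of this derivative is a weighted integral of `⟨η, x⟩ ^ 2 / ε` with positive
weight, so its vanishing forces `⟨η, x⟩ = 0` almost everywhere. -/
theorem fderiv_moment_inr_injective (hinv : IsUnit (secondMoment ν)) {ε : ℝ} (hε : 0 < ε)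
    {k : Euc dx × Euc dy → ℝ} (hk : Integrable k ν) (hpos : ∀ z, 0 < k z)
    (p : Euc dy × Euc dx) {η : Euc dx} (h : fderiv ℝ (moment ν ε k) p (0, η) = 0) : η = 0 := by
  apply eq_zero_of_ae_inner_eq_zero hK hν hinv
  have h0 := inner_fderiv_moment_inr hK hν (ε := ε) hk p η
  rw [h, inner_zero_right, eq_comm, integral_eq_zero_iff_of_nonneg] at h0
  · filter_upwards [h0] with z hz
    simpa [(hpos z).ne', hε.ne'] using hz
  · intro z
    have := hpos z
    simp only [Pi.zero_apply]
    positivity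
  · exact integrable_tilt hK hν hk p (by fun_prop)

/-- Otherwise `⟨η, X⟩ ≤ 0` almost surely; being centred, it would then vanish almost surely. -/
theorem integral_posPart_pos (hmean : ∫ z, z.1 ∂ν = 0) (hinv : IsUnit (secondMoment ν))
    {k : Euc dx × Euc dy → ℝ} (hk : Integrable k ν) (hpos : ∀ z, 0 < k z) {η : Euc dx}
    (hη : η ≠ 0) : 0 < ∫ z, max (inner ℝ η z.1) 0 * k z ∂ν := by
  have hnn : 0 ≤ fun z : Euc dx × Euc dy => max (inner ℝ η z.1) 0 * k z :=
    fun z => mul_nonneg (le_max_right _ _) (hpos z).le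
  refine lt_of_le_of_ne (integral_nonneg hnn) fun h0 => hη ?_
  apply eq_zero_of_ae_inner_eq_zero hK hν hinv
  rw [eq_comm, integral_eq_zero_iff_of_nonneg hnn
    (integrable_continuous_smul hK hν (by fun_prop) hk)] at h0
  have hle : ∀ᵐ z ∂ν, 0 ≤ -inner ℝ η z.1 := by
    filter_upwards [h0] with z hz
    simpa [(hpos z).ne'] using hz
  have hzero : ∫ z, -inner ℝ η z.1 ∂ν = 0 := by
    rw [integral_neg, integral_inner (integrable_fst hK hν), hmean, inner_zero_right, neg_zero]
  rw [integral_eq_zero_iff_of_nonneg_ae hle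
    (integrable_of_continuous hK hν (by fun_prop))] at hzero
  filter_upwards [hzero] with z hz
  simpa using hz

/-- Positivity becomes uniform on the compact unit sphere by continuity, and extends to all `η` by
homogeneity. -/
theorem exists_pos_mul_norm_le_integral_posPart (hmean : ∫ z, z.1 ∂ν = 0) (hinv : IsUnit (secondMoment ν))
    {k : Euc dx × Euc dy → ℝ} (hk : Integrable k ν) (hpos : ∀ z, 0 < k z) :
    ∃ δ > 0, ∀ η : Euc dx, δ * ‖η‖ ≤ ∫ z, max (inner ℝ η z.1) 0 * k z ∂ν := by
  obtain ⟨C, hC⟩ := hK.exists_bound_of_continuousOn (f := fun z : Euc dx × Euc dy => z.1)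
    continuous_fst.continuousOn
  have hcont : ContinuousOn (fun η : Euc dx => ∫ z, max (inner ℝ η z.1) 0 * k z ∂ν)
      (Metric.sphere 0 1) := by
    refine continuousOn_of_dominated (bound := fun z => C * k z) (fun η _ => ?_) (fun η hη => ?_)
      (hk.const_mul C) (ae_of_all _ fun z => by fun_prop)
    · exact (integrable_continuous_smul hK hν (by fun_prop) hk).aestronglyMeasurable
    · filter_upwards [hν] with z hz
      rw [norm_mul, Real.norm_of_nonneg (hpos z).le, Real.norm_of_nonneg (le_max_right _ _)]
      refine mul_le_mul_of_nonneg_right (max_le ?_ ((norm_nonneg _).trans (hC z hz))) (hpos z).le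
      have := real_inner_le_norm η z.1
      rw [mem_sphere_zero_iff_norm.mp hη, one_mul] at this
      exact this.trans (hC z hz)
  obtain ⟨δ, hδ, h⟩ := (isCompact_sphere (0 : Euc dx) 1).exists_forall_le' hcont (a := 0)
    fun η hη => integral_posPart_pos hK hν hmean hinv hk hpos
      (norm_ne_zero_iff.mp (by rw [mem_sphere_zero_iff_norm.mp hη]; exact one_ne_zero))
  refine ⟨δ, hδ, fun η => ?_⟩
  rcases eq_or_ne η 0 with rfl | hη
  · simp
  have hn : 0 < ‖η‖ := norm_pos_iff.mpr hη
  have h1 := h (‖η‖⁻¹ • η) (by simp [norm_smul, hn.ne'])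
  have h2 : ∫ z, max (inner ℝ (‖η‖⁻¹ • η) z.1) 0 * k z ∂ν =
      ‖η‖⁻¹ * ∫ z, max (inner ℝ η z.1) 0 * k z ∂ν := by
    rw [← integral_const_mul]
    refine integral_congr_ae (ae_of_all _ fun z => ?_)
    simp only [inner_smul_left, conj_trivial]
    rw [← mul_assoc, mul_max_of_nonneg _ _ (inv_nonneg.mpr hn.le), mul_zero]
  rw [h2, inv_mul_eq_div, le_div_iff₀ hn] at h1
  exact h1

/-- The zero is a minimiser in `θ` of `partition`, which exists because `exp t ≥ max t 0` gives at
least linear growth. -/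
theorem exists_moment_eq_zero (hmean : ∫ z, z.1 ∂ν = 0) (hinv : IsUnit (secondMoment ν))
    {ε : ℝ} (hε : 0 < ε) {k : Euc dx × Euc dy → ℝ} (hk : Integrable k ν) (hpos : ∀ z, 0 < k z)
    (u : Euc dy) : ∃ θ, moment ν ε k (u, θ) = 0 := by
  -- For fixed `u`, the factor in `⟨u, y⟩` is absorbed into the weight.
  have hk' : Integrable (fun z => Real.exp (inner ℝ u z.2 / ε) * k z) ν :=
    integrable_continuous_smul hK hν (by fun_prop) hk
  obtain ⟨δ, hδ, hcoer⟩ := exists_pos_mul_norm_le_integral_posPart hK hν hmean hinv hk'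
    fun z => mul_pos (Real.exp_pos _) (hpos z)
  have hlow (θ : Euc dx) : δ / ε * ‖θ‖ ≤ partition ν ε k (u, θ) := by
    have h1 : δ / ε * ‖θ‖ = (δ * ‖θ‖) / ε := by ring
    rw [h1]
    refine (div_le_div_of_nonneg_right (hcoer θ) hε.le).trans ?_
    rw [← integral_div]
    have hc := continuous_pairing (dx := dx) (dy := dy) ε
    refine integral_mono ?_ (integrable_continuous_smul hK hν (by fun_prop) hk) fun z => ?_
    · exact (integrable_continuous_smul hK hν (by fun_prop) hk').div_const ε
    · have hsplit : Real.exp (pairing ε z (u, θ)) =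
          Real.exp (inner ℝ θ z.1 / ε) * Real.exp (inner ℝ u z.2 / ε) := by
        rw [pairing_apply, add_div, Real.exp_add]
      have hexp : max (inner ℝ θ z.1) 0 / ε ≤ Real.exp (inner ℝ θ z.1 / ε) := by
        rw [← max_div_div_right hε.le, zero_div]
        refine max_le ?_ (Real.exp_pos _).le
        linarith [Real.add_one_le_exp (inner ℝ θ z.1 / ε)]
      simp only [smul_eq_mul]
      rw [hsplit, mul_div_right_comm, mul_assoc]
      exact mul_le_mul_of_nonneg_right hexp (mul_pos (Real.exp_pos _) (hpos z)).le
  have hdiff (θ : Euc dx) : HasFDerivAt (fun θ => partition ν ε k (u, θ))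
      ((fderiv ℝ (partition ν ε k) (u, θ)).comp (ContinuousLinearMap.inr ℝ (Euc dy) (Euc dx))) θ :=
    ((analyticAt_partition hK hν hk (u, θ)).differentiableAt.hasFDerivAt).comp θ
      (hasFDerivAt_prodMk_right u θ)
  have hcont : Continuous fun θ => partition ν ε k (u, θ) :=
    continuous_iff_continuousAt.mpr fun θ => (hdiff θ).continuousAt
  obtain ⟨θ, hθ⟩ := hcont.exists_forall_le
    (tendsto_atTop_mono hlow (tendsto_norm_cocompact_atTop.const_mul_atTop (div_pos hδ hε)))
  refine ⟨θ, ?_⟩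
  have hmin : IsLocalMin (fun θ => partition ν ε k (u, θ)) θ := Eventually.of_forall hθ
  -- The vanishing derivative is tested in the direction of the moment itself, which yields its
  -- squared norm divided by `ε`.
  have h0 := congrArg (fun L => L (moment ν ε k (u, θ))) (hmin.hasFDerivAt_eq_zero (hdiff θ))
  simp only [ContinuousLinearMap.comp_apply, ContinuousLinearMap.inr_apply,
    zero_apply] at h0
  rw [fderiv_partition_inr hK hν hk] at h0
  simpa [hε.ne'] using h0

theorem analyticAt_of_moment_eq_zero (hinv : IsUnit (secondMoment ν))
    {ε : ℝ} (hε : 0 < ε) {k : Euc dx × Euc dy → ℝ} (hk : Integrable k ν) (hpos : ∀ z, 0 < k z)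
    {g : Euc dy → Euc dx} (hg : ∀ u, moment ν ε k (u, g u) = 0) (u : Euc dy) :
    AnalyticAt ℝ g u := by
  have hcd : ContDiffAt ℝ ω (moment ν ε k) (u, g u) :=
    (analyticAt_moment hK hν hk (u, g u)).contDiffAt
  set L := (fderiv ℝ (moment ν ε k) (u, g u)).comp
    (ContinuousLinearMap.inr ℝ (Euc dy) (Euc dx)) with hL
  have hinj : Function.Injective L.toLinearMap := by
    refine (injective_iff_map_eq_zero _).mpr fun η hη => ?_
    exact fderiv_moment_inr_injective hK hν hinv hε hk hpos (u, g u) hη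
  have hinvert : L.IsInvertible :=
    -- An injective endomorphism of a finite-dimensional space is invertible.
    ⟨(LinearEquiv.ofInjectiveEndo L.toLinearMap hinj).toContinuousLinearEquiv, by ext; rfl⟩
  have hψ := hcd.contDiffAt_implicitFunction (by simp) hinvert
  have hev := hcd.eventually_apply_implicitFunction (by simp) hinvert
  -- Zeros in `θ` are globally unique, so the implicit function agrees with `g` near `u` without any
  -- prior continuity of `g`.
  refine hψ.analyticAt.congr ?_
  filter_upwards [hev] with u' hu'
  exact moment_injective hK hν hinv hε hk hpos (hu'.trans ((hg u).trans (hg u').symm))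

end

/-! ### First-order optimality of dual potentials -/

/-- The density `exp ((f(u) + ⟨g(u), x⟩ + h(x,y) - c(u,y)) / ε)`. -/
noncomputable def gibbs {dx dy : ℕ} (ε : ℝ) (f : Euc dy → ℝ) (g : Euc dy → Euc dx)
    (h : Euc dx × Euc dy → ℝ) (p : Euc dy × (Euc dx × Euc dy)) : ℝ :=
  Real.exp ((f p.1 + inner ℝ (g p.1) p.2.1 + h p.2 - cost p.1 p.2.2) / ε)

theorem gibbs_pos {dx dy : ℕ} (ε : ℝ) (f : Euc dy → ℝ) (g : Euc dy → Euc dx)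
    (h : Euc dx × Euc dy → ℝ) (p : Euc dy × (Euc dx × Euc dy)) : 0 < gibbs ε f g h p :=
  Real.exp_pos _

theorem continuous_cost {dy : ℕ} : Continuous fun p : Euc dy × Euc dy => cost p.1 p.2 := by
  unfold cost
  fun_prop

/-- The difference of the two sides has a local minimum at `t = 0`, with derivative `b - a` there.
This extracts the first-order condition without differentiating under the integral. -/
theorem eq_of_forall_mul_le_sq {a b M δ : ℝ} (hδ : 0 < δ)
    (h : ∀ t, |t| < δ → t * a ≤ t * b + t ^ 2 * M) : a = b := by
  have hmin : IsLocalMin (fun t : ℝ => t * (b - a) + t ^ 2 * M) 0 := by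
    filter_upwards [Metric.ball_mem_nhds (0 : ℝ) hδ] with t ht
    have := h t (by simpa using ht)
    simp only [zero_mul, ne_eq, OfNat.ofNat_ne_zero, not_false_eq_true, zero_pow, add_zero]
    linarith
  have hd : HasDerivAt (fun t : ℝ => t * (b - a) + t ^ 2 * M) (b - a) 0 := by
    have hd := ((hasDerivAt_id (0 : ℝ)).mul_const (b - a)).add
      (((hasDerivAt_id (0 : ℝ)).pow 2).mul_const M)
    simp only [one_mul, id_eq, Nat.add_one_sub_one, pow_one, mul_zero, zero_mul, mul_one, add_zero] at hd
    exact hd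
  linarith [hmin.hasDerivAt_eq_zero hd]

section
variable {dx dy : ℕ} {μ : Measure (Euc dy)} [IsProbabilityMeasure μ]
  {ν : Measure (Euc dx × Euc dy)} [IsProbabilityMeasure ν] {ε : ℝ}
  {f : Euc dy → ℝ} {g : Euc dy → Euc dx} {h : Euc dx × Euc dy → ℝ}

omit [IsProbabilityMeasure μ] [IsProbabilityMeasure ν] in
theorem aestronglyMeasurable_gibbs (hf : AEStronglyMeasurable f μ)
    (hg : AEStronglyMeasurable g μ) (hh : AEStronglyMeasurable h ν) :
    AEStronglyMeasurable (gibbs ε f g h) (μ.prod ν) := by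
  have hc : AEStronglyMeasurable (fun p : Euc dy × (Euc dx × Euc dy) => cost p.1 p.2.2)
      (μ.prod ν) :=
    (continuous_cost.comp (by fun_prop : Continuous
      fun p : Euc dy × (Euc dx × Euc dy) => (p.1, p.2.2))).aestronglyMeasurable
  have hx : AEStronglyMeasurable (fun p : Euc dy × (Euc dx × Euc dy) => p.2.1) (μ.prod ν) :=
    (by fun_prop : Continuous fun p : Euc dy × (Euc dx × Euc dy) => p.2.1).aestronglyMeasurable
  have he := ((hf.comp_fst (ν := ν)).add ((hg.comp_fst (ν := ν)).inner (𝕜 := ℝ) hx)).add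
    (hh.comp_snd (μ := μ)) |>.sub hc
  exact (by fun_prop : Continuous fun t : ℝ => Real.exp (t / ε)).comp_aestronglyMeasurable he

omit [IsProbabilityMeasure μ] [IsProbabilityMeasure ν] in
theorem dualObjective_eq_coe (hint : Integrable (gibbs ε f g h) (μ.prod ν)) :
    dualObjective μ ν ε f g h =
      ((∫ u, f u ∂μ + ∫ z, h z ∂ν - (ε * ∫ p, gibbs ε f g h p ∂(μ.prod ν) - ε) : ℝ) : EReal) := by
  have hl := ofReal_integral_eq_lintegral_ofReal hint (ae_of_all _ fun p => (gibbs_pos ε f g h p).le)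
  have hnn : 0 ≤ ∫ p, gibbs ε f g h p ∂(μ.prod ν) :=
    integral_nonneg fun p => (gibbs_pos ε f g h p).le
  simp only [gibbs] at hl hnn
  rw [dualObjective, ← hl, EReal.coe_ennreal_ofReal, max_eq_left hnn]
  norm_cast

/-- An infinite integral would make the objective `⊥`, whereas the zero triple has a finite value
because the cost is nonnegative. -/
theorem IsDualPotentials.integrable_gibbs (hε : 0 < ε) (hd : IsDualPotentials μ ν ε f g h) :
    Integrable (gibbs ε f g h) (μ.prod ν) := by
  have hm := aestronglyMeasurable_gibbs (ε := ε) hd.integrable_f.1 hd.integrable_g.1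
    hd.integrable_h.1
  refine ⟨hm, ?_⟩
  rw [hasFiniteIntegral_iff_ofReal (ae_of_all _ fun p => (gibbs_pos ε f g h p).le),
    lt_top_iff_ne_top]
  intro htop
  have hbot : dualObjective μ ν ε f g h = ⊥ := by
    simp only [gibbs] at htop
    rw [dualObjective, htop, EReal.coe_ennreal_top, EReal.coe_mul_top_of_pos hε,
      EReal.top_sub_coe, EReal.sub_top]
  have h0 : Integrable (gibbs ε (fun _ => 0) (fun _ => 0) (fun _ => 0) :
      Euc dy × (Euc dx × Euc dy) → ℝ) (μ.prod ν) := by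
    refine Integrable.of_bound (aestronglyMeasurable_gibbs aestronglyMeasurable_const
      aestronglyMeasurable_const aestronglyMeasurable_const) 1 (ae_of_all _ fun p => ?_)
    rw [Real.norm_of_nonneg (gibbs_pos ε _ _ _ p).le, gibbs, Real.exp_le_one_iff]
    simp only [inner_zero_left, add_zero, zero_sub, cost]
    exact div_nonpos_of_nonpos_of_nonneg (by simp; positivity) hε.le
  have hle := hd.isMax _ _ _ (integrable_zero _ _ μ) (integrable_zero _ _ μ) (integrable_zero _ _ ν)
  rw [hbot, le_bot_iff] at hle
  have := dualObjective_eq_coe h0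
  exact EReal.coe_ne_bot _ (this.symm.trans hle)

theorem gibbs_add_smul (t : ℝ) (φ : Euc dy → ℝ) (ψ : Euc dy → Euc dx) (χ : Euc dx × Euc dy → ℝ)
    (p : Euc dy × (Euc dx × Euc dy)) :
    gibbs ε (fun u => f u + t * φ u) (fun u => g u + t • ψ u) (fun z => h z + t * χ z) p =
      Real.exp (t * ((φ p.1 + inner ℝ (ψ p.1) p.2.1 + χ p.2) / ε)) * gibbs ε f g h p := by
  rw [gibbs, gibbs, ← Real.exp_add]
  congr 1
  rw [inner_add_left, inner_smul_left]
  simp only [conj_trivial]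
  ring

/-- The first-order optimality condition for dual potentials. -/
theorem IsDualPotentials.integral_add_integral_eq (hε : 0 < ε)
    (hd : IsDualPotentials μ ν ε f g h) {φ : Euc dy → ℝ} {ψ : Euc dy → Euc dx}
    {χ : Euc dx × Euc dy → ℝ} (hφ : Integrable φ μ) (hψ : Integrable ψ μ) (hχ : Integrable χ ν)
    {C : ℝ} (hC : ∀ᵐ p ∂(μ.prod ν), |φ p.1 + inner ℝ (ψ p.1) p.2.1 + χ p.2| ≤ C) :
    ∫ u, φ u ∂μ + ∫ z, χ z ∂ν =
      ∫ p, (φ p.1 + inner ℝ (ψ p.1) p.2.1 + χ p.2) * gibbs ε f g h p ∂(μ.prod ν) := by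
  have hw := hd.integrable_gibbs hε
  set a : Euc dy × (Euc dx × Euc dy) → ℝ :=
    fun p => φ p.1 + inner ℝ (ψ p.1) p.2.1 + χ p.2 with ha
  have hx : AEStronglyMeasurable (fun p : Euc dy × (Euc dx × Euc dy) => p.2.1) (μ.prod ν) :=
    (by fun_prop : Continuous fun p : Euc dy × (Euc dx × Euc dy) => p.2.1).aestronglyMeasurable
  have ham : AEStronglyMeasurable a (μ.prod ν) :=
    ((hφ.1.comp_fst (ν := ν)).add ((hψ.1.comp_fst (ν := ν)).inner (𝕜 := ℝ) hx)).add
      (hχ.1.comp_snd (μ := μ))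
  have hC0 : 0 ≤ C := by
    obtain ⟨p, hp⟩ := hC.exists
    exact (abs_nonneg _).trans hp
  have haw : Integrable (fun p => a p * gibbs ε f g h p) (μ.prod ν) := hw.bdd_mul ham hC
  set W := ∫ p, gibbs ε f g h p ∂(μ.prod ν) with hW
  -- This `δ` keeps the perturbed exponent in `[-1, 1]`, where `exp s ≤ 1 + s + s ^ 2`; integrating
  -- the quadratic term gives `M`. Using `C + 1` avoids a division by zero.
  refine eq_of_forall_mul_le_sq (δ := ε / (C + 1)) (M := C ^ 2 / ε * W) (by positivity)
    fun t ht => ?_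
  rw [lt_div_iff₀ (by positivity)] at ht
  have hsmall : ∀ᵐ p ∂(μ.prod ν), |t * (a p / ε)| ≤ 1 := by
    filter_upwards [hC] with p hp
    rw [abs_mul, abs_div, abs_of_pos hε, ← mul_div_assoc, div_le_one hε]
    nlinarith [abs_nonneg t, mul_le_mul_of_nonneg_left hp (abs_nonneg t)]
  have hwt : Integrable (gibbs ε (fun u => f u + t * φ u) (fun u => g u + t • ψ u)
      (fun z => h z + t * χ z)) (μ.prod ν) := by
    simp only [funext (gibbs_add_smul (ε := ε) (f := f) (g := g) (h := h) t φ ψ χ)]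
    refine hw.bdd_mul (c := Real.exp 1) ?_ ?_
    · exact (by fun_prop : Continuous fun s : ℝ => Real.exp (t * (s / ε))).comp_aestronglyMeasurable
        ham
    · filter_upwards [hsmall] with p hp
      rw [Real.norm_of_nonneg (Real.exp_pos _).le, Real.exp_le_exp]
      exact (le_abs_self _).trans hp
  have hmax := hd.isMax _ _ _ (hd.integrable_f.add (hφ.const_mul t))
    (hd.integrable_g.add (hψ.smul t)) (hd.integrable_h.add (hχ.const_mul t))
  have hmax' : dualObjective μ ν ε (fun u => f u + t * φ u) (fun u => g u + t • ψ u)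
    (fun z => h z + t * χ z) ≤ dualObjective μ ν ε f g h := hmax
  rw [dualObjective_eq_coe hw, dualObjective_eq_coe hwt, EReal.coe_le_coe_iff,
    integral_add hd.integrable_f (hφ.const_mul t), integral_add hd.integrable_h (hχ.const_mul t),
    integral_const_mul, integral_const_mul] at hmax'
  have hupper : ∫ p, gibbs ε (fun u => f u + t * φ u) (fun u => g u + t • ψ u)
      (fun z => h z + t * χ z) p ∂(μ.prod ν) ≤
      ∫ p, ((1 + (t * C / ε) ^ 2) * gibbs ε f g h p + t / ε * (a p * gibbs ε f g h p))
        ∂(μ.prod ν) := by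
    refine integral_mono_ae hwt ((hw.const_mul _).add (haw.const_mul _)) ?_
    filter_upwards [hsmall, hC] with p hp hpC
    rw [gibbs_add_smul]
    have h1 := (abs_le.mp (Real.abs_exp_sub_one_sub_id_le hp)).2
    have h2 : (t * (a p / ε)) ^ 2 ≤ (t * C / ε) ^ 2 := by
      have : a p ^ 2 ≤ C ^ 2 := sq_le_sq' (by linarith [(abs_le.mp hpC).1]) (abs_le.mp hpC).2
      have h3 : (t * (a p / ε)) ^ 2 = (t / ε) ^ 2 * a p ^ 2 := by ring
      have h4 : (t * C / ε) ^ 2 = (t / ε) ^ 2 * C ^ 2 := by ring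
      rw [h3, h4]
      exact mul_le_mul_of_nonneg_left this (sq_nonneg _)
    have h5 : Real.exp (t * (a p / ε)) ≤ (1 + (t * C / ε) ^ 2) + t / ε * a p := by
      have : t * (a p / ε) = t / ε * a p := by ring
      linarith
    have := mul_le_mul_of_nonneg_right h5 (gibbs_pos ε f g h p).le
    linarith
  rw [integral_add (hw.const_mul _) (haw.const_mul _), integral_const_mul, integral_const_mul,
    ← hW] at hupper
  have h6 := mul_le_mul_of_nonneg_left hupper hε.le
  have h7 : ε * ((1 + (t * C / ε) ^ 2) * W +
      t / ε * ∫ p, a p * gibbs ε f g h p ∂(μ.prod ν)) =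
      ε * W + t ^ 2 * (C ^ 2 / ε * W) + t * ∫ p, a p * gibbs ε f g h p ∂(μ.prod ν) := by
    field_simp
  linarith

/-- Perturbing `f` alone by indicators identifies the integral of this marginal over every
measurable set. -/
theorem IsDualPotentials.ae_integral_gibbs_right (hε : 0 < ε)
    (hd : IsDualPotentials μ ν ε f g h) : ∀ᵐ u ∂μ, ∫ z, gibbs ε f g h (u, z) ∂ν = 1 := by
  have hw := hd.integrable_gibbs hε
  refine hw.integral_prod_left.ae_eq_of_forall_setIntegral_eq _ _ (integrable_const 1)
    fun A hA _ => ?_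
  have hfo := hd.integral_add_integral_eq hε (φ := A.indicator fun _ => 1) (ψ := 0) (χ := 0)
    ((integrable_const 1).indicator hA) (integrable_zero _ _ _) (integrable_zero _ _ _) (C := 1)
    (ae_of_all _ fun p => by by_cases hp : p.1 ∈ A <;> simp [hp])
  have hmul : (fun p : Euc dy × (Euc dx × Euc dy) => (A.indicator (fun _ => (1 : ℝ)) p.1 +
      inner ℝ ((0 : Euc dy → Euc dx) p.1) p.2.1 + (0 : Euc dx × Euc dy → ℝ) p.2) *
      gibbs ε f g h p) = fun p => A.indicator (fun _ => (1 : ℝ)) p.1 * gibbs ε f g h p := by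
    simp
  have hint : Integrable (fun p : Euc dy × (Euc dx × Euc dy) =>
      A.indicator (fun _ => (1 : ℝ)) p.1 * gibbs ε f g h p) (μ.prod ν) :=
    hw.bdd_mul (c := 1) (((measurable_const.indicator hA).comp measurable_fst).aestronglyMeasurable)
      (ae_of_all _ fun p => by by_cases hp : p.1 ∈ A <;> simp [hp])
  rw [hmul, integral_prod _ hint, integral_indicator hA] at hfo
  simp only [integral_const_mul, Pi.zero_apply, integral_zero, add_zero] at hfo
  rw [hfo, ← integral_indicator hA]
  refine integral_congr_ae (ae_of_all _ fun u => ?_)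
  by_cases hu : u ∈ A <;> simp [hu]

theorem IsDualPotentials.ae_integral_gibbs_left (hε : 0 < ε)
    (hd : IsDualPotentials μ ν ε f g h) : ∀ᵐ z ∂ν, ∫ u, gibbs ε f g h (u, z) ∂μ = 1 := by
  have hw := hd.integrable_gibbs hε
  refine hw.integral_prod_right.ae_eq_of_forall_setIntegral_eq _ _ (integrable_const 1)
    fun A hA _ => ?_
  have hfo := hd.integral_add_integral_eq hε (φ := 0) (ψ := 0) (χ := A.indicator fun _ => 1)
    (integrable_zero _ _ _) (integrable_zero _ _ _) ((integrable_const 1).indicator hA) (C := 1)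
    (ae_of_all _ fun p => by by_cases hp : p.2 ∈ A <;> simp [hp])
  have hmul : (fun p : Euc dy × (Euc dx × Euc dy) => ((0 : Euc dy → ℝ) p.1 +
      inner ℝ ((0 : Euc dy → Euc dx) p.1) p.2.1 + A.indicator (fun _ => (1 : ℝ)) p.2) *
      gibbs ε f g h p) = fun p => A.indicator (fun _ => (1 : ℝ)) p.2 * gibbs ε f g h p := by
    simp
  have hint : Integrable (fun p : Euc dy × (Euc dx × Euc dy) =>
      A.indicator (fun _ => (1 : ℝ)) p.2 * gibbs ε f g h p) (μ.prod ν) :=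
    hw.bdd_mul (c := 1) (((measurable_const.indicator hA).comp measurable_snd).aestronglyMeasurable)
      (ae_of_all _ fun p => by by_cases hp : p.2 ∈ A <;> simp [hp])
  rw [hmul, integral_prod_symm _ hint, integral_indicator hA] at hfo
  simp only [integral_const_mul, Pi.zero_apply, integral_zero, zero_add] at hfo
  rw [hfo, ← integral_indicator hA]
  refine integral_congr_ae (ae_of_all _ fun u => ?_)
  by_cases hu : u ∈ A <;> simp [hu]

/-- Here `g` is perturbed by a fixed vector `e` on a measurable set. Compactness in `x` keeps `⟨e,
x⟩` bounded, as the first-order condition requires. -/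
theorem IsDualPotentials.ae_integral_gibbs_smul_fst (hε : 0 < ε)
    {K : Set (Euc dx × Euc dy)} (hK : IsCompact K) (hν : ∀ᵐ z ∂ν, z ∈ K)
    (hd : IsDualPotentials μ ν ε f g h) :
    ∀ᵐ u ∂μ, ∫ z, gibbs ε f g h (u, z) • z.1 ∂ν = 0 := by
  have hw := hd.integrable_gibbs hε
  obtain ⟨R, hR⟩ := hK.exists_bound_of_continuousOn (f := fun z : Euc dx × Euc dy => z.1)
    continuous_fst.continuousOn
  have hK' : ∀ᵐ p ∂(μ.prod ν), ‖p.2.1‖ ≤ R :=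
    Measure.quasiMeasurePreserving_snd.ae (hν.mono hR)
  have hx : AEStronglyMeasurable (fun p : Euc dy × (Euc dx × Euc dy) => p.2.1) (μ.prod ν) :=
    (by fun_prop : Continuous fun p : Euc dy × (Euc dx × Euc dy) => p.2.1).aestronglyMeasurable
  have hwx : Integrable (fun p => gibbs ε f g h p • p.2.1) (μ.prod ν) := hw.smul_bdd R hx hK'
  refine hwx.integral_prod_left.ae_eq_of_forall_setIntegral_eq _ _ (integrable_zero _ _ _)
    fun A hA _ => ?_
  simp only [integral_zero]
  refine ext_inner_left ℝ fun e => ?_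
  rw [inner_zero_right, ← integral_inner hwx.integral_prod_left.integrableOn]
  have hR0 : 0 ≤ R := by
    obtain ⟨p, hp⟩ := hK'.exists
    exact (norm_nonneg _).trans hp
  have hbd : ∀ᵐ p ∂(μ.prod ν), |inner ℝ (A.indicator (fun _ => e) p.1) p.2.1| ≤ ‖e‖ * R := by
    filter_upwards [hK'] with p hp
    refine (abs_real_inner_le_norm _ _).trans (mul_le_mul ?_ hp (norm_nonneg _) (norm_nonneg _))
    exact norm_indicator_le_norm_self (fun _ => e) p.1
  have hfo := hd.integral_add_integral_eq hε (φ := 0) (ψ := A.indicator fun _ => e) (χ := 0)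
    (integrable_zero _ _ _) ((integrable_const e).indicator hA) (integrable_zero _ _ _)
    (C := ‖e‖ * R) (by simpa using hbd)
  simp only [Pi.zero_apply, zero_add, add_zero, integral_zero] at hfo
  have hint : Integrable (fun p : Euc dy × (Euc dx × Euc dy) =>
      inner ℝ (A.indicator (fun _ => e) p.1) p.2.1 * gibbs ε f g h p) (μ.prod ν) :=
    hw.bdd_mul (c := ‖e‖ * R) (((measurable_const.indicator hA).comp
      measurable_fst).aestronglyMeasurable.inner (𝕜 := ℝ) hx) hbd
  rw [integral_prod _ hint] at hfo
  rw [hfo, ← integral_indicator hA]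
  refine integral_congr_ae ?_
  filter_upwards [hwx.prod_right_ae] with u hu
  by_cases huA : u ∈ A
  · simp only [huA, Set.indicator_of_mem]
    rw [← integral_inner hu]
    refine integral_congr_ae (ae_of_all _ fun z => ?_)
    simp only [inner_smul_right]
    ring
  · simp [huA]

end

/-! ### Translation of the extended-valued system; existence of versions; regularity of `g` and `f`
-/

/-- The weight `exp ((h(x,y) - ‖y‖² / 2) / ε)`. -/
noncomputable def baseWeight {dx dy : ℕ} (ε : ℝ) (h : Euc dx × Euc dy → ℝ)
    (z : Euc dx × Euc dy) : ℝ :=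
  Real.exp ((h z - ‖z.2‖ ^ 2 / 2) / ε)

theorem exp_coe_add_coe_div (a b ε : ℝ) :
    EReal.exp (((a : EReal) + (b : EReal)) / (ε : EReal)) =
      ENNReal.ofReal (Real.exp ((a + b) / ε)) := by
  rw [← EReal.coe_add, ← EReal.coe_div, EReal.exp_coe]

theorem neg_mul_log_ofReal (ε : ℝ) {r : ℝ} (hr : 0 < r) :
    -((ε : EReal) * ENNReal.log (ENNReal.ofReal r)) = ((-(ε * Real.log r) : ℝ) : EReal) := by
  rw [ENNReal.log_ofReal_of_pos hr, ← EReal.coe_mul, ← EReal.coe_neg]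

theorem neg_mul_log_ofReal_exp {ε : ℝ} (hε : 0 < ε) (a : ℝ) :
    -((ε : EReal) * ENNReal.log (ENNReal.ofReal (Real.exp (-(a / ε))))) = (a : EReal) := by
  rw [neg_mul_log_ofReal ε (Real.exp_pos _), Real.log_exp]
  congr 1
  field_simp

/-- Expanding `‖u - y‖ ^ 2` leaves `⟨u, y⟩` as the only coupling between `u` and `y`. -/
theorem exp_cost_factor {dx dy : ℕ} (ε a : ℝ) (θ : Euc dx) (u : Euc dy) (z : Euc dx × Euc dy) :
    Real.exp ((a + (inner ℝ θ z.1 - cost u z.2)) / ε) =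
      Real.exp (-(‖u‖ ^ 2 / 2 / ε)) *
        (Real.exp (pairing ε z (u, θ)) * Real.exp ((a - ‖z.2‖ ^ 2 / 2) / ε)) := by
  rw [← Real.exp_add, ← Real.exp_add, pairing_apply, cost, norm_sub_sq_real]
  congr 1
  ring

theorem weight_eq_ofReal {dx dy : ℕ} {ε : ℝ} {h : Euc dx × Euc dy → EReal}
    {h₀ : Euc dx × Euc dy → ℝ} {z : Euc dx × Euc dy} (hz : h z = (h₀ z : EReal))
    (θ : Euc dx) (u : Euc dy) :
    weight ε h θ u z = ENNReal.ofReal (Real.exp (-(‖u‖ ^ 2 / 2 / ε)) *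
      (Real.exp (pairing ε z (u, θ)) * baseWeight ε h₀ z)) := by
  rw [weight, hz, exp_coe_add_coe_div, exp_cost_factor, baseWeight]

theorem gibbs_eq_mul {dx dy : ℕ} (ε : ℝ) (f : Euc dy → ℝ) (g : Euc dy → Euc dx)
    (h : Euc dx × Euc dy → ℝ) (u : Euc dy) (z : Euc dx × Euc dy) :
    gibbs ε f g h (u, z) = Real.exp (f u / ε) * (Real.exp (-(‖u‖ ^ 2 / 2 / ε)) *
      (Real.exp (pairing ε z (u, g u)) * baseWeight ε h z)) := by
  rw [baseWeight, ← exp_cost_factor, ← Real.exp_add, gibbs]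
  congr 1
  ring

theorem baseWeight_pos {dx dy : ℕ} (ε : ℝ) (h : Euc dx × Euc dy → ℝ) (z : Euc dx × Euc dy) :
    0 < baseWeight ε h z := Real.exp_pos _

theorem integral_exp_mul_pos {Ω : Type*} [MeasurableSpace Ω] {ρ : Measure Ω} [NeZero ρ]
    {φ : Ω → ℝ} (hφ : ∀ z, 0 < φ z) (hint : Integrable φ ρ) : 0 < ∫ z, φ z ∂ρ := by
  rw [integral_pos_iff_support_of_nonneg (fun z => (hφ z).le) hint]
  have : Function.support φ = Set.univ := Set.eq_univ_of_forall fun z => (hφ z).ne'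
  rw [this]
  exact Measure.measure_univ_pos.mpr (NeZero.ne ρ)

section
variable {dx dy : ℕ} {ν : Measure (Euc dx × Euc dy)} [IsProbabilityMeasure ν]
  {K : Set (Euc dx × Euc dy)} (hK : IsCompact K) (hν : ∀ᵐ z ∂ν, z ∈ K) {ε : ℝ}

include hK hν

omit [IsProbabilityMeasure ν] in
theorem integrable_exp_pairing_mul {k : Euc dx × Euc dy → ℝ} (hk : Integrable k ν)
    (p : Euc dy × Euc dx) : Integrable (fun z => Real.exp (pairing ε z p) * k z) ν := by
  simpa using integrable_tilt hK hν (ε := ε) hk p (continuous_const (y := (1 : ℝ)))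

theorem partition_pos {k : Euc dx × Euc dy → ℝ} (hk : Integrable k ν) (hpos : ∀ z, 0 < k z)
    (p : Euc dy × Euc dx) : 0 < partition ν ε k p :=
  integral_exp_mul_pos (fun z => mul_pos (Real.exp_pos _) (hpos z))
    (integrable_exp_pairing_mul hK hν hk p)

omit [IsProbabilityMeasure ν] in
theorem lintegral_weight {h : Euc dx × Euc dy → EReal} {h₀ : Euc dx × Euc dy → ℝ}
    (hh : h =ᵐ[ν] fun z => (h₀ z : EReal)) (hk : Integrable (baseWeight ε h₀) ν)
    (θ : Euc dx) (u : Euc dy) :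
    ∫⁻ z, weight ε h θ u z ∂ν = ENNReal.ofReal (Real.exp (-(‖u‖ ^ 2 / 2 / ε)) *
      partition ν ε (baseWeight ε h₀) (u, θ)) := by
  rw [lintegral_congr_ae (hh.mono fun z hz => weight_eq_ofReal hz θ u),
    ← ofReal_integral_eq_lintegral_ofReal, integral_const_mul]
  · rfl
  · exact (integrable_exp_pairing_mul hK hν hk _).const_mul _
  · exact ae_of_all _ fun z => by
      have := baseWeight_pos ε h₀ z
      positivity

omit hK hν [IsProbabilityMeasure ν] in
theorem weight_toReal_smul_ae_eq {h : Euc dx × Euc dy → EReal} {h₀ : Euc dx × Euc dy → ℝ}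
    (hh : h =ᵐ[ν] fun z => (h₀ z : EReal)) (θ : Euc dx) (u : Euc dy) :
    (fun z => (weight ε h θ u z).toReal • z.1) =ᵐ[ν] fun z => Real.exp (-(‖u‖ ^ 2 / 2 / ε)) •
      (Real.exp (pairing ε z (u, θ)) • (baseWeight ε h₀ z • z.1)) := by
  filter_upwards [hh] with z hz
  have := baseWeight_pos ε h₀ z
  rw [weight_eq_ofReal hz, ENNReal.toReal_ofReal (by positivity), mul_smul, mul_smul]

omit hK hν [IsProbabilityMeasure ν] in
theorem integral_weight_smul {h : Euc dx × Euc dy → EReal} {h₀ : Euc dx × Euc dy → ℝ}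
    (hh : h =ᵐ[ν] fun z => (h₀ z : EReal)) (θ : Euc dx) (u : Euc dy) :
    ∫ z, (weight ε h θ u z).toReal • z.1 ∂ν =
      Real.exp (-(‖u‖ ^ 2 / 2 / ε)) • moment ν ε (baseWeight ε h₀) (u, θ) := by
  rw [integral_congr_ae (weight_toReal_smul_ae_eq hh θ u), integral_smul]
  rfl

omit [IsProbabilityMeasure ν] in
theorem integrable_weight_smul {h : Euc dx × Euc dy → EReal} {h₀ : Euc dx × Euc dy → ℝ}
    (hh : h =ᵐ[ν] fun z => (h₀ z : EReal)) (hk : Integrable (baseWeight ε h₀) ν)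
    (θ : Euc dx) (u : Euc dy) :
    Integrable (fun z => (weight ε h θ u z).toReal • z.1) ν := by
  refine Integrable.congr ?_ (weight_toReal_smul_ae_eq hh θ u).symm
  have hc := continuous_pairing (dx := dx) (dy := dy) ε
  have hint := integrable_continuous_smul hK hν (φ := fun z => Real.exp (pairing ε z (u, θ)))
    (by fun_prop) (integrable_smul_fst hK hν hk)
  exact hint.smul (Real.exp (-(‖u‖ ^ 2 / 2 / ε)))

variable {μ : Measure (Euc dy)} [IsProbabilityMeasure μ]
  {f₀ : Euc dy → ℝ} {g₀ : Euc dy → Euc dx} {h₀ : Euc dx × Euc dy → ℝ}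

/-- By Fubini some slice of the Gibbs density is integrable, and its quotient with the weight is
continuous and positive in `z`, hence bounded above and away from zero on `K`. -/
theorem IsDualPotentials.integrable_baseWeight (hε : 0 < ε)
    (hd : IsDualPotentials μ ν ε f₀ g₀ h₀) : Integrable (baseWeight ε h₀) ν := by
  obtain ⟨u, hu⟩ := (hd.integrable_gibbs hε).prod_right_ae.exists
  have hc := continuous_pairing (dx := dx) (dy := dy) ε
  have h1 := integrable_continuous_smul hK hν (φ := fun z : Euc dx × Euc dy =>
    (Real.exp (f₀ u / ε) * (Real.exp (-(‖u‖ ^ 2 / 2 / ε)) *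
      (Real.exp (pairing ε z (u, g₀ u)))))⁻¹)
    (Continuous.inv₀ (by fun_prop) fun z => by positivity) hu
  refine h1.congr (ae_of_all _ fun z => ?_)
  simp only [gibbs_eq_mul, smul_eq_mul]
  field_simp

theorem IsDualPotentials.ae_moment_eq_zero (hε : 0 < ε)
    (hd : IsDualPotentials μ ν ε f₀ g₀ h₀) :
    ∀ᵐ u ∂μ, moment ν ε (baseWeight ε h₀) (u, g₀ u) = 0 := by
  filter_upwards [hd.ae_integral_gibbs_smul_fst hε hK hν] with u hu
  simp only [gibbs_eq_mul, mul_smul, integral_smul] at hu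
  simpa [Real.exp_ne_zero, moment] using hu

omit hK hν in
theorem IsDualPotentials.ae_partition_eq (hε : 0 < ε)
    (hd : IsDualPotentials μ ν ε f₀ g₀ h₀) :
    ∀ᵐ u ∂μ, Real.exp (-(‖u‖ ^ 2 / 2 / ε)) * partition ν ε (baseWeight ε h₀) (u, g₀ u) =
      Real.exp (-(f₀ u / ε)) := by
  filter_upwards [hd.ae_integral_gibbs_right hε] with u hu
  simp only [gibbs_eq_mul, integral_const_mul] at hu
  rw [Real.exp_neg (f₀ u / ε)]
  exact eq_inv_of_mul_eq_one_right hu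

omit hK hν in
theorem IsDualPotentials.ae_lintegral_exp_eq (hε : 0 < ε)
    (hd : IsDualPotentials μ ν ε f₀ g₀ h₀) {f : Euc dy → EReal} {g : Euc dy → Euc dx}
    (hf : f =ᵐ[μ] fun u => (f₀ u : EReal)) (hg : g =ᵐ[μ] g₀) :
    ∀ᵐ z ∂ν, ∫⁻ u, EReal.exp ((f u + ((inner ℝ (g u) z.1 - cost u z.2 : ℝ) : EReal)) /
      (ε : EReal)) ∂μ = ENNReal.ofReal (Real.exp (-(h₀ z / ε))) := by
  filter_upwards [hd.ae_integral_gibbs_left hε, (hd.integrable_gibbs hε).prod_left_ae]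
    with z hz hint
  have hfac (u : Euc dy) : Real.exp ((f₀ u + (inner ℝ (g₀ u) z.1 - cost u z.2)) / ε) =
      Real.exp (-(h₀ z / ε)) * gibbs ε f₀ g₀ h₀ (u, z) := by
    rw [gibbs, ← Real.exp_add]
    congr 1
    ring
  have hae : (fun u => EReal.exp ((f u + ((inner ℝ (g u) z.1 - cost u z.2 : ℝ) : EReal)) /
      (ε : EReal))) =ᵐ[μ] fun u =>
      ENNReal.ofReal (Real.exp (-(h₀ z / ε)) * gibbs ε f₀ g₀ h₀ (u, z)) := by
    filter_upwards [hf, hg] with u hfu hgu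
    rw [hfu, hgu, exp_coe_add_coe_div, hfac]
  rw [lintegral_congr_ae hae, ← ofReal_integral_eq_lintegral_ofReal (hint.const_mul _)
    (ae_of_all _ fun u => (mul_pos (Real.exp_pos _) (gibbs_pos _ _ _ _ _)).le),
    integral_const_mul, hz, mul_one]

/-- Dual potentials have versions that solve the Schrödinger-like system everywhere. -/
theorem IsDualPotentials.exists_version (hε : 0 < ε) (hmean : ∫ z, z.1 ∂ν = 0)
    (hinv : IsUnit (secondMoment ν)) (hd : IsDualPotentials μ ν ε f₀ g₀ h₀) :
    ∃ (f : Euc dy → EReal) (g : Euc dy → Euc dx) (h : Euc dx × Euc dy → EReal),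
      IsVersion μ ν f₀ g₀ h₀ f g h ∧ SolvesSystem μ ν ε f g h := by
  have hk := hd.integrable_baseWeight hK hν hε
  have hpos := baseWeight_pos ε h₀
  -- All of `g`, `f`, `h` are built from `h₀`. Once `h = h₀` almost everywhere is known, `h` can
  -- replace `h₀` in the equations integrated against `ν`.
  choose g hg using exists_moment_eq_zero hK hν hmean hinv hε hk hpos
  have hgae : g =ᵐ[μ] g₀ := by
    filter_upwards [hd.ae_moment_eq_zero hK hν hε] with u hu
    exact moment_injective hK hν hinv hε hk hpos ((hg u).trans hu.symm)
  set f : Euc dy → EReal := fun u => -((ε : EReal) * ENNReal.log (ENNReal.ofReal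
    (Real.exp (-(‖u‖ ^ 2 / 2 / ε)) * partition ν ε (baseWeight ε h₀) (u, g u)))) with hf
  have hfae : f =ᵐ[μ] fun u => (f₀ u : EReal) := by
    filter_upwards [hd.ae_partition_eq hε, hgae] with u hu hgu
    rw [hf]
    simp only
    rw [hgu, hu, neg_mul_log_ofReal_exp hε]
  set h : Euc dx × Euc dy → EReal := fun z => -((ε : EReal) * ENNReal.log
    (∫⁻ u, EReal.exp ((f u + ((inner ℝ (g u) z.1 - cost u z.2 : ℝ) : EReal)) / (ε : EReal)) ∂μ))
    with hh
  have hhae : h =ᵐ[ν] fun z => (h₀ z : EReal) := by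
    filter_upwards [hd.ae_lintegral_exp_eq hε hfae hgae] with z hz
    rw [hh]
    simp only
    rw [hz, neg_mul_log_ofReal_exp hε]
  refine ⟨f, g, h, ⟨hfae, hgae, hhae⟩, ⟨fun u => ?_, fun u => ?_, fun u => ?_, fun x y => rfl⟩⟩
  · rw [lintegral_weight hK hν hhae hk]
  · exact integrable_weight_smul hK hν hhae hk _ _
  · rw [integral_weight_smul hhae, hg, smul_zero]

variable {f : Euc dy → EReal} {g : Euc dy → Euc dx} {h : Euc dx × Euc dy → EReal}

omit [IsProbabilityMeasure μ] in
theorem SolvesSystem.f_eq_coe (hk : Integrable (baseWeight ε h₀) ν) (hε : 0 < ε)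
    (hh : h =ᵐ[ν] fun z => (h₀ z : EReal)) (hs : SolvesSystem μ ν ε f g h) (u : Euc dy) :
    f u = ((‖u‖ ^ 2 / 2 - ε * Real.log (partition ν ε (baseWeight ε h₀) (u, g u)) : ℝ) :
      EReal) := by
  have hp := partition_pos hK hν (ε := ε) hk (baseWeight_pos ε h₀) (u, g u)
  rw [hs.eq_f, lintegral_weight hK hν hh hk, neg_mul_log_ofReal ε (by positivity),
    Real.log_mul (Real.exp_ne_zero _) hp.ne', Real.log_exp]
  congr 1
  field_simp
  ring

omit [IsProbabilityMeasure μ] in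
-- The second equation, up to a positive scalar, says that `g u` is a zero of the moment map of the
-- fixed weight built from `h₀`.
theorem SolvesSystem.analyticAt_g (hk : Integrable (baseWeight ε h₀) ν) (hε : 0 < ε)
    (hinv : IsUnit (secondMoment ν))
    (hh : h =ᵐ[ν] fun z => (h₀ z : EReal)) (hs : SolvesSystem μ ν ε f g h) (u : Euc dy) :
    AnalyticAt ℝ g u := by
  refine analyticAt_of_moment_eq_zero hK hν hinv hε hk (baseWeight_pos ε h₀) (fun u => ?_) u
  have := hs.eq_g u
  rw [integral_weight_smul hh] at this
  simpa [Real.exp_ne_zero] using this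

omit [IsProbabilityMeasure μ] in
theorem SolvesSystem.analyticAt_f (hk : Integrable (baseWeight ε h₀) ν) (hε : 0 < ε)
    (hinv : IsUnit (secondMoment ν))
    (hh : h =ᵐ[ν] fun z => (h₀ z : EReal)) (hs : SolvesSystem μ ν ε f g h) (u : Euc dy) :
    AnalyticAt ℝ (fun u => (f u).toReal) u := by
  have hfun : (fun u => (f u).toReal) = fun u =>
      ‖u‖ ^ 2 / 2 - ε * Real.log (partition ν ε (baseWeight ε h₀) (u, g u)) := by
    ext u
    rw [hs.f_eq_coe hK hν hk hε hh, EReal.toReal_coe]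
  rw [hfun]
  have hg := hs.analyticAt_g hK hν hk hε hinv hh u
  have hp : AnalyticAt ℝ (fun u => partition ν ε (baseWeight ε h₀) (u, g u)) u :=
    (analyticAt_partition hK hν hk (u, g u)).comp₂ analyticAt_id hg
  have hn : AnalyticAt ℝ (fun u : Euc dy => ‖u‖ ^ 2) u :=
    (contDiff_norm_sq ℝ (n := ω)).contDiffAt.analyticAt
  have hpos : 0 < partition ν ε (baseWeight ε h₀) (u, g u) :=
    partition_pos hK hν hk (baseWeight_pos ε h₀) _
  have hl := (analyticAt_log hpos).fun_comp_of_eq hp rfl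
  exact hn.div_const.sub (analyticAt_const.mul hl)

end

/-! ### Regularity of `h` -/

section
variable {dx dy : ℕ} {μ : Measure (Euc dy)} [IsProbabilityMeasure μ] {ε : ℝ}
  {F : Euc dy → ℝ} {g : Euc dy → Euc dx}

/-- The exponential integral over `μ` that determines `h`. -/
noncomputable def dualPartition (μ : Measure (Euc dy)) (ε : ℝ) (F : Euc dy → ℝ)
    (g : Euc dy → Euc dx) (p : Euc dy × Euc dx) : ℝ :=
  ∫ u, Real.exp (pairing ε (g u, u) p) • Real.exp ((F u - ‖u‖ ^ 2 / 2) / ε) ∂μ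

/-- The bilinear pairing is read the other way: `(y, x)` is now the parameter and `(g u, u)` the
integration point. Continuity on the compact support gives integrability. -/
theorem lintegral_exp_eq_dualPartition (hμ : IsCompact μ.support) (hF : Continuous F)
    (hg : Continuous g) (x : Euc dx) (y : Euc dy) :
    0 < dualPartition μ ε F g (y, x) ∧
    ∫⁻ u, EReal.exp (((F u : EReal) + ((inner ℝ (g u) x - cost u y : ℝ) : EReal)) / (ε : EReal))
      ∂μ = ENNReal.ofReal (Real.exp (-(‖y‖ ^ 2 / 2 / ε)) * dualPartition μ ε F g (y, x)) := by
  have hc := (continuous_pairing (dx := dx) (dy := dy) ε).comp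
    (hg.prodMk (continuous_id (X := Euc dy)))
  have hc' : Continuous fun u => pairing ε (g u, u) (y, x) := hc.clm_apply continuous_const
  have hint : Integrable (fun u => Real.exp (pairing ε (g u, u) (y, x)) •
      Real.exp ((F u - ‖u‖ ^ 2 / 2) / ε)) μ := by
    simpa using integrable_continuous_smul hμ Measure.support_mem_ae
      (φ := fun u => Real.exp (pairing ε (g u, u) (y, x)) • Real.exp ((F u - ‖u‖ ^ 2 / 2) / ε))
      (by fun_prop) (integrable_const (1 : ℝ))
  refine ⟨integral_exp_mul_pos (fun u => by positivity) hint, ?_⟩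
  rw [dualPartition, ← integral_const_mul, ofReal_integral_eq_lintegral_ofReal
    (hint.const_mul _) (ae_of_all _ fun u => by positivity)]
  refine lintegral_congr fun u => ?_
  rw [exp_coe_add_coe_div, smul_eq_mul, ← Real.exp_add, ← Real.exp_add, pairing_apply, cost,
    norm_sub_sq_real, real_inner_comm x, real_inner_comm u y]
  congr 2
  ring

theorem analyticAt_dualPartition (hμ : IsCompact μ.support) (hF : Continuous F)
    (hg : Continuous g) (p : Euc dy × Euc dx) : AnalyticAt ℝ (dualPartition μ ε F g) p := by
  have hc := (continuous_pairing (dx := dx) (dy := dy) ε).comp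
    (hg.prodMk (continuous_id (X := Euc dy)))
  refine analyticAt_integral_exp hμ Measure.support_mem_ae ?_ hc.continuousOn p
  simpa using integrable_continuous_smul hμ Measure.support_mem_ae
    (φ := fun u => Real.exp ((F u - ‖u‖ ^ 2 / 2) / ε)) (by fun_prop) (integrable_const (1 : ℝ))

end

/-- When the marginal supports are compact, this product is the compact set of full measure used as
`K`. -/
theorem ae_mem_support_prod_support {dx dy : ℕ} (ν : Measure (Euc dx × Euc dy)) :
    ∀ᵐ z ∂ν, z ∈ (ν.map Prod.fst).support ×ˢ (ν.map Prod.snd).support := by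
  filter_upwards [ae_of_ae_map measurable_fst.aemeasurable
      (Measure.support_mem_ae (μ := ν.map Prod.fst)),
    ae_of_ae_map measurable_snd.aemeasurable
      (Measure.support_mem_ae (μ := ν.map Prod.snd))] with z h1 h2
  exact ⟨h1, h2⟩

theorem SolvesSystem.h_eq_coe {dx dy : ℕ} {μ : Measure (Euc dy)} [IsProbabilityMeasure μ]
    {ν : Measure (Euc dx × Euc dy)} {ε : ℝ} (hε : 0 < ε)
    {f : Euc dy → EReal} {g : Euc dy → Euc dx} {h : Euc dx × Euc dy → EReal}
    (hμ : IsCompact μ.support) {F : Euc dy → ℝ} (hfF : ∀ u, f u = (F u : EReal))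
    (hF : Continuous F) (hg : Continuous g) (hs : SolvesSystem μ ν ε f g h)
    (z : Euc dx × Euc dy) :
    h z = ((‖z.2‖ ^ 2 / 2 - ε * Real.log (dualPartition μ ε F g (z.2, z.1)) : ℝ) : EReal) := by
  obtain ⟨hp, hl⟩ := lintegral_exp_eq_dualPartition (ε := ε) hμ hF hg z.1 z.2
  have hz := hs.eq_h z.1 z.2
  simp only [hfF, hl] at hz
  rw [neg_mul_log_ofReal ε (by positivity), Real.log_mul (Real.exp_ne_zero _) hp.ne',
    Real.log_exp] at hz
  refine hz.trans ?_
  congr 1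
  field_simp
  ring

end EntropicVQR

/-! ### The main theorem -/

theorem mainTheorem2 {dx dy : ℕ}
    (μ : Measure (EntropicVQR.Euc dy)) [IsProbabilityMeasure μ]
    (ν : Measure (EntropicVQR.Euc dx × EntropicVQR.Euc dy)) [IsProbabilityMeasure ν]
    (ε : ℝ) (hε : 0 < ε)
    (hμ : IsCompact μ.support)
    (hX : IsCompact (ν.map Prod.fst).support)
    (hY : IsCompact (ν.map Prod.snd).support)
    (hmean : ∫ z, z.1 ∂ν = 0)
    (hinv : IsUnit (EntropicVQR.secondMoment ν))
    (f₀ : EntropicVQR.Euc dy → ℝ) (g₀ : EntropicVQR.Euc dy → EntropicVQR.Euc dx)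
    (h₀ : EntropicVQR.Euc dx × EntropicVQR.Euc dy → ℝ)
    (hdual : EntropicVQR.IsDualPotentials μ ν ε f₀ g₀ h₀) :
    (∃ (f : EntropicVQR.Euc dy → EReal) (g : EntropicVQR.Euc dy → EntropicVQR.Euc dx)
        (h : EntropicVQR.Euc dx × EntropicVQR.Euc dy → EReal),
        EntropicVQR.IsVersion μ ν f₀ g₀ h₀ f g h ∧ EntropicVQR.SolvesSystem μ ν ε f g h) ∧
    ∀ (f : EntropicVQR.Euc dy → EReal) (g : EntropicVQR.Euc dy → EntropicVQR.Euc dx)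
      (h : EntropicVQR.Euc dx × EntropicVQR.Euc dy → EReal),
      EntropicVQR.IsVersion μ ν f₀ g₀ h₀ f g h → EntropicVQR.SolvesSystem μ ν ε f g h →
        (∀ u, f u ≠ ⊥ ∧ f u ≠ ⊤) ∧ (∀ z, h z ≠ ⊥ ∧ h z ≠ ⊤) ∧
        AnalyticOnNhd ℝ (fun u => (f u).toReal) Set.univ ∧
        (∀ i, AnalyticOnNhd ℝ (fun u => g u i) Set.univ) ∧
        AnalyticOnNhd ℝ (fun z => (h z).toReal) Set.univ := by
  have hK := hX.prod hY
  have hν := EntropicVQR.ae_mem_support_prod_support ν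
  refine ⟨hdual.exists_version hK hν hε hmean hinv, fun f g h hv hs => ?_⟩
  have hk := hdual.integrable_baseWeight hK hν hε
  have hf := hs.f_eq_coe hK hν hk hε hv.h_ae
  have hfa := hs.analyticAt_f hK hν hk hε hinv hv.h_ae
  have hga := hs.analyticAt_g hK hν hk hε hinv hv.h_ae
  have hfF (u) : f u = ((f u).toReal : EReal) := by rw [hf, EReal.toReal_coe]
  have hFc : Continuous fun u => (f u).toReal :=
    continuous_iff_continuousAt.mpr fun u => (hfa u).continuousAt
  have hgc : Continuous g := continuous_iff_continuousAt.mpr fun u => (hga u).continuousAt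
  -- Only the continuity of `f` and `g` passes to `h`; its analyticity comes from the exponential
  -- kernel.
  have hh := hs.h_eq_coe hε hμ hfF hFc hgc
  refine ⟨fun u => ?_, fun z => ?_, fun u _ => hfa u, fun i u _ => ?_, fun z _ => ?_⟩
  · rw [hf]
    exact ⟨EReal.coe_ne_bot _, EReal.coe_ne_top _⟩
  · rw [hh]
    exact ⟨EReal.coe_ne_bot _, EReal.coe_ne_top _⟩
  · exact ((EuclideanSpace.proj (𝕜 := ℝ) i).analyticAt (g u)).comp (hga u)
  · simp only [hh, EReal.toReal_coe]
    have hn : AnalyticAt ℝ (fun z : EntropicVQR.Euc dx × EntropicVQR.Euc dy => ‖z.2‖ ^ 2) z :=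
      ((contDiff_norm_sq ℝ (n := ⊤)).comp contDiff_snd).contDiffAt.analyticAt
    have hp : AnalyticAt ℝ (fun z : EntropicVQR.Euc dx × EntropicVQR.Euc dy =>
        EntropicVQR.dualPartition μ ε (fun u => (f u).toReal) g (z.2, z.1)) z :=
      (EntropicVQR.analyticAt_dualPartition hμ hFc hgc (z.2, z.1)).comp₂ analyticAt_snd
        analyticAt_fst
    have hpos : 0 < EntropicVQR.dualPartition μ ε (fun u => (f u).toReal) g (z.2, z.1) :=
      (EntropicVQR.lintegral_exp_eq_dualPartition hμ hFc hgc z.1 z.2).1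
    have hl := (analyticAt_log hpos).fun_comp_of_eq hp rfl
    exact hn.div_const.sub (analyticAt_const.mul hl)
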